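/- For $n\ge 3$ let $V=\{0,\dots,n-1\}^2$ and let $T$ be the two-dimensional undirected torus of size $n$, i.e. the graph on $V$ in which each $(i,j)$ is joined to $(i,(j+1)\bmod n)$ and to $((i+1)\bmod n,j)$. Let $d_{uv}$ be the distance between $u$ and $v$ in $T$. Independently for each $u\in V$, the vertex $u$ chooses one vertex $v\in V\setminus\{u\}$ with probability $Z_u\,d_{uv}^{-2}$, where $Z_u=\bigl(\sum_{w\in V\setminus\{u\}}d_{uw}^{-2}\bigr)^{-1}$. The random undirected toroidal small world (UTSW) graph $G$ is the simple graph obtained from $T$ by adding, for each $u$, the edge joining $u$ to the vertex it chose (if it is not already present). The long-range edges removing algorithm LRERA processes each vertex $u$ of $G$ as follows. 1. By depth-first search of depth four it finds all four-cycles $(u,v_2,v_3,v_4)$ of $G$ with root $u$ and four distinct vertices, and then, going once through these cycles in some order, it keeps a cycle unless its reversal $(u,v_4,v_3,v_2)$ has already been kept. Let $\mathcal L$ be the resulting set. 2. To each set $\mathcal C\subseteq\mathcal L$ of four distinct cycles it applies the following lattice pattern recognition. Choose an arbitrary $C^0=(c^0_1,c^0_2,c^0_3,c^0_4)\in\mathcal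 C$, remove it from $\mathcal C$, and set $S=\{c^0_1,c^0_3,c^0_4\}$ and $a_0=c^0_4$. For $k=1,2,3$: find a remaining cycle $C^k=(c^k_1,c^k_2,c^k_3,c^k_4)$ with $c^k_2=a_{k-1}$ or $c^k_4=a_{k-1}$; return "false" if there is none, or if $(\{c^k_2,c^k_3,c^k_4\}\setminus\{a_{k-1}\})\cap S\neq\emptyset$; otherwise remove $C^k$ from $\mathcal C$, replace $S$ by $S\cup\{c^k_2,c^k_3,c^k_4\}$, and let $a_k$ be the element of $\{c^k_2,c^k_4\}\setminus\{a_{k-1}\}$. Finally return "true" if $a_3=c^0_2$, and "false" otherwise. 3. Let $E''_u$ be the set of all edges incident to $u$ of the cycles in those sets $\mathcal C$ for which "true" was returned. The vertex $u$ is detected if and only if $|E''_u|=4$; in that case all edges of $G$ incident to $u$ that are not in $E''_u$ are removed. **Corollary.** Let $D_n$ be the number of vertices of the UTSW graph of size $n$ that LRERA detects. Then, however the arbitrary choices and the orders of the loops in the algorithm are resolved, $$\lim_{n\to\infty}\frac{\mathbb E[D_n]}{|V|}=\lim_{n\to\infty}\frac{\mathbb E[D_n]}{n^2}=1 .$$ 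-/

import Mathlib

open MeasureTheory Filter Topology

namespace UTSW

/-! The random graph. -/

/-- The vertices of the torus of size `n`: the elements of `{0, …, n-1}²`. -/
abbrev Vertex (n : ℕ) := Fin n × Fin n

/-- The two-dimensional undirected torus of size `n`: each `(i, j)` is joined to
`(i, (j + 1) mod n)` and to `((i + 1) mod n, j)`. -/
def torus (n : ℕ) : SimpleGraph (Vertex n) :=
  SimpleGraph.fromRel fun u v =>
    (v.1 = u.1 ∧ (v.2 : ℕ) = ((u.2 : ℕ) + 1) % n) ∨
    ((v.1 : ℕ) = ((u.1 : ℕ) + 1) % n ∧ v.2 = u.2)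

/-- `min (|x - y|, n - |x - y|)` -/
def circDist (n : ℕ) (x y : Fin n) : ℕ :=
  min ((x : ℤ) - (y : ℤ)).natAbs (n - ((x : ℤ) - (y : ℤ)).natAbs)

/-- The distance `d u v` on the torus; see `torus_dist_eq`. -/
def tdist {n : ℕ} (u v : Vertex n) : ℕ :=
  circDist n u.1 v.1 + circDist n u.2 v.2

/-- The normalizing factor at `u`, the inverse of `∑_{w ≠ u} d(u,w)⁻²`. -/
noncomputable def normFactor {n : ℕ} (u : Vertex n) : ℝ :=
  (∑ w ∈ Finset.univ.erase u, ((tdist u w : ℝ) ^ 2)⁻¹)⁻¹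

/-- The law of the long-range choice of `u`: a vertex `v ≠ u` has probability
`Z_u * d(u,v)⁻²`. -/
noncomputable def choiceLaw {n : ℕ} (u : Vertex n) : Measure (Vertex n) :=
  ∑ v ∈ Finset.univ.erase u,
    ENNReal.ofReal (normFactor u * ((tdist u v : ℝ) ^ 2)⁻¹) • Measure.dirac v

/-- An assignment of a chosen vertex to every vertex. -/
abbrev Choices (n : ℕ) := Vertex n → Vertex n

/-- The joint law of the choices: the vertices choose independently. -/
noncomputable def choicesLaw (n : ℕ) : Measure (Choices n) :=
  Measure.pi fun u => choiceLaw u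

/-- The UTSW graph: the torus together with the undirected edges `{u, ω u}`
(no parallel edges, no loops). -/
def graph {n : ℕ} (ω : Choices n) : SimpleGraph (Vertex n) :=
  torus n ⊔ SimpleGraph.fromRel fun u v => ω u = v

/-! The algorithms. Whenever the pseudo-code says "choose an arbitrary", "find a" or
"for each" (in unspecified order), every resolution is allowed. -/

/-- A four-cycle `(c₁, c₂, c₃, c₄)` with root `c₁`. -/
abbrev Cycle (V : Type*) := V × V × V × V

section Algorithms

variable {V : Type*} [Fintype V] [DecidableEq V]

/-- The set of neighbours of `w`. -/
noncomputable def nbrs (G : SimpleGraph V) (w : V) : Finset V :=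
  open Classical in Finset.univ.filter fun x => G.Adj w x

/-- The recursive four-cycles search from the root `u`, unrolled: depth-first search of
depth four through distinct vertices, keeping the paths whose last vertex is adjacent to `u`. -/
noncomputable def recursiveSearch (G : SimpleGraph V) (u : V) : Finset (Cycle V) :=
  (nbrs G u \ {u}).biUnion fun v₂ =>
    (nbrs G v₂ \ {u, v₂}).biUnion fun v₃ =>
      (nbrs G v₃ \ {u, v₂, v₃}).biUnion fun v₄ =>
        if u ∈ nbrs G v₄ then {(u, v₂, v₃, v₄)} else ∅

/-- The body of the duplication removing loop: `c` is added unless its reverse is present. -/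
def keepUnlessReversed (R : Finset (Cycle V)) (c : Cycle V) : Finset (Cycle V) :=
  if (c.1, c.2.2.2, c.2.2.1, c.2.1) ∉ R then insert c R else R

/-- `R` is a possible output of the duplication removing algorithm on `S`: the loop visits the
elements of `S` once each, in some order `l`. -/
def DuplicationRemoval (S R : Finset (Cycle V)) : Prop :=
  ∃ l : List (Cycle V), l.Nodup ∧ l.toFinset = S ∧ R = l.foldl keepUnlessReversed ∅

/-- `L` is a possible output of the four-cycles search on `(G, u)`. -/
def FourCyclesSearch (G : SimpleGraph V) (u : V) (L : Finset (Cycle V)) : Prop :=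
  DuplicationRemoval (recursiveSearch G u) L

/-- `PatternLoop t k C S a r`: the main loop of the lattice pattern recognition algorithm, with
`k` iterations left, remaining cycles `C`, visited vertices `S` and current vertex `a`, can
return `r`; at the end `a` is compared with `t`. -/
inductive PatternLoop (t : V) : ℕ → Finset (Cycle V) → Finset V → V → Bool → Prop
  | finish (C : Finset (Cycle V)) (S : Finset V) (a : V) :
      PatternLoop t 0 C S a (decide (a = t))
  | notFound (k : ℕ) (C : Finset (Cycle V)) (S : Finset V) (a : V)
      (h : ∀ c ∈ C, ¬ (c.2.1 = a ∨ c.2.2.2 = a)) :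
      PatternLoop t (k + 1) C S a false
  | clash (k : ℕ) (C : Finset (Cycle V)) (S : Finset V) (a : V) (c : Cycle V)
      (hc : c ∈ C) (ha : c.2.1 = a ∨ c.2.2.2 = a)
      (h : (({c.2.1, c.2.2.1, c.2.2.2} : Finset V) \ {a}) ∩ S ≠ ∅) :
      PatternLoop t (k + 1) C S a false
  | next (k : ℕ) (C : Finset (Cycle V)) (S : Finset V) (a : V) (c : Cycle V)
      (hc : c ∈ C) (ha : c.2.1 = a ∨ c.2.2.2 = a)
      (h : (({c.2.1, c.2.2.1, c.2.2.2} : Finset V) \ {a}) ∩ S = ∅)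
      (a' : V) (ha' : a' ∈ ({c.2.1, c.2.2.2} : Finset V) \ {a}) (r : Bool)
      (hr : PatternLoop t k (C.erase c) (S ∪ {c.2.1, c.2.2.1, c.2.2.2}) a' r) :
      PatternLoop t (k + 1) C S a r

/-- The lattice pattern recognition algorithm on the set `C` of cycles can return `r`. -/
def PatternRecognition (C : Finset (Cycle V)) (r : Bool) : Prop :=
  ∃ c ∈ C, PatternLoop c.2.1 3 (C.erase c) {c.1, c.2.2.1, c.2.2.2} c.2.2.2 r

/-- The edges of a four-cycle. -/
def cycleEdges (c : Cycle V) : Finset (Sym2 V) :=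
  {s(c.1, c.2.1), s(c.2.1, c.2.2.1), s(c.2.2.1, c.2.2.2), s(c.2.2.2, c.1)}

/-- A run of the long-range edges removing algorithm on `G`: for each vertex `u`, the outcome of
the four-cycles search at `u`, and the answers of the lattice pattern recognition algorithm on
all sets of four distinct cycles found (the values of `answer` elsewhere play no role). -/
structure LRERARun (G : SimpleGraph V) where
  cycles : V → Finset (Cycle V)
  cycles_spec : ∀ u, FourCyclesSearch G u (cycles u)
  answer : V → Finset (Cycle V) → Bool
  answer_spec : ∀ u, ∀ C ∈ (cycles u).powersetCard 4, PatternRecognition C (answer u C)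

namespace LRERARun

variable {G : SimpleGraph V}

/-- The set of edges collected at `u`: all the edges incident to `u` of the cycles in a set of
four cycles on which the answer was "true". -/
def collected (run : LRERARun G) (u : V) : Finset (Sym2 V) :=
  (((run.cycles u).powersetCard 4).filter fun C => run.answer u C = true).biUnion fun C =>
    (C.biUnion cycleEdges).filter fun e => u ∈ e

/-- The set of detected vertices. -/
def detected (run : LRERARun G) : Finset V :=
  Finset.univ.filter fun u => (run.collected u).card = 4

/-- The returned graph: for each detected `u`, the edges of `G` incident to `u` that were not
collected at `u` are removed. -/
def output (run : LRERARun G) : SimpleGraph V :=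
  G.deleteEdges {e | ∃ u ∈ run.detected, u ∈ e ∧ e ∉ run.collected u}

end LRERARun

/-! Facts showing that the definitions are sound. -/

theorem recursiveSearch_ne {G : SimpleGraph V} {u : V} {c : Cycle V}
    (h : c ∈ recursiveSearch G u) : c.2.1 ≠ c.2.2.2 := by
  simp only [recursiveSearch, Finset.mem_biUnion, Finset.mem_sdiff, Finset.mem_insert,
    Finset.mem_singleton, not_or] at h
  obtain ⟨v₂, -, v₃, -, v₄, ⟨-, -, h₄, -⟩, h⟩ := h
  split_ifs at h
  · rw [Finset.mem_singleton] at h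
    subst h
    exact fun h => h₄ h.symm
  · simp at h

theorem foldl_keep_subset (l : List (Cycle V)) (R : Finset (Cycle V)) :
    l.foldl keepUnlessReversed R ⊆ R ∪ l.toFinset := by
  induction l generalizing R with
  | nil => simp
  | cons c l ih =>
    intro x hx
    have := ih _ hx
    simp only [keepUnlessReversed] at this
    split_ifs at this <;> simp_all

theorem patternLoop_exists (t : V) (k : ℕ) (C : Finset (Cycle V))
    (hC : ∀ c ∈ C, c.2.1 ≠ c.2.2.2) (S : Finset V) (a : V) : ∃ r, PatternLoop t k C S a r := by
  induction k generalizing C S a with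
  | zero => exact ⟨_, .finish C S a⟩
  | succ k ih =>
    by_cases h : ∃ c ∈ C, c.2.1 = a ∨ c.2.2.2 = a
    · obtain ⟨c, hc, ha⟩ := h
      by_cases hS : (({c.2.1, c.2.2.1, c.2.2.2} : Finset V) \ {a}) ∩ S = ∅
      · have hne := hC c hc
        obtain ⟨a', ha'⟩ : ∃ a', a' ∈ ({c.2.1, c.2.2.2} : Finset V) \ {a} := by
          rcases ha with ha | ha
          · exact ⟨c.2.2.2, by simp [← ha, hne.symm]⟩
          · exact ⟨c.2.1, by simp [← ha, hne]⟩
        obtain ⟨r, hr⟩ := ih (C.erase c) (fun x hx => hC x (Finset.mem_of_mem_erase hx))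
          (S ∪ {c.2.1, c.2.2.1, c.2.2.2}) a'
        exact ⟨r, .next k C S a c hc ha hS a' ha' r hr⟩
      · exact ⟨false, .clash k C S a c hc ha hS⟩
    · push Not at h
      exact ⟨false, .notFound k C S a (by simpa using h)⟩

/-- The algorithm has a run on every graph. -/
theorem nonempty_LRERARun (G : SimpleGraph V) : Nonempty (LRERARun G) := by
  classical
  let L : V → Finset (Cycle V) := fun u =>
    (recursiveSearch G u).toList.foldl keepUnlessReversed ∅
  have key : ∀ u, ∀ C ∈ (L u).powersetCard 4, ∃ r, PatternRecognition C r := by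
    intro u C hC
    rw [Finset.mem_powersetCard] at hC
    have hne : ∀ c ∈ C, c.2.1 ≠ c.2.2.2 := fun c hc => by
      have := foldl_keep_subset _ _ (hC.1 hc)
      simp at this
      exact recursiveSearch_ne this
    obtain ⟨c, hc⟩ : C.Nonempty := Finset.card_pos.1 (by omega)
    obtain ⟨r, hr⟩ := patternLoop_exists c.2.1 3 (C.erase c)
      (fun x hx => hne x (Finset.mem_of_mem_erase hx)) {c.1, c.2.2.1, c.2.2.2} c.2.2.2
    exact ⟨r, c, hc, hr⟩
  exact ⟨{
    cycles := L
    cycles_spec := fun u => ⟨_, Finset.nodup_toList _, Finset.toList_toFinset _, rfl⟩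
    answer := fun u C => if h : C ∈ (L u).powersetCard 4 then (key u C h).choose else false
    answer_spec := fun u C hC => by
      rw [dif_pos hC]
      exact (key u C hC).choose_spec }⟩

end Algorithms

theorem torus_adj {n : ℕ} {u v : Vertex n} : (torus n).Adj u v ↔ u ≠ v ∧
    (((v.1 = u.1 ∧ (v.2 : ℕ) = ((u.2 : ℕ) + 1) % n) ∨
      ((v.1 : ℕ) = ((u.1 : ℕ) + 1) % n ∧ v.2 = u.2)) ∨
     ((u.1 = v.1 ∧ (u.2 : ℕ) = ((v.2 : ℕ) + 1) % n) ∨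
      ((u.1 : ℕ) = ((v.1 : ℕ) + 1) % n ∧ u.2 = v.2))) := by
  simp [torus, SimpleGraph.fromRel_adj]

theorem succ_mod_eq {n a b : ℕ} (hb : b < n) (h : a = (b + 1) % n) :
    a = b + 1 ∨ (a = 0 ∧ b + 1 = n) := by
  rcases Nat.lt_or_ge (b + 1) n with h' | h'
  · rw [Nat.mod_eq_of_lt h'] at h
    exact .inl h
  · have : b + 1 = n := by omega
    rw [this, Nat.mod_self] at h
    exact .inr ⟨h, this⟩

theorem circDist_succ {n : ℕ} {a b : Fin n} (c : Fin n) (h : (a : ℕ) = ((b : ℕ) + 1) % n) :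
    circDist n a c ≤ circDist n b c + 1 ∧ circDist n b c ≤ circDist n a c + 1 := by
  have ha := a.2
  have hb := b.2
  have hc := c.2
  simp only [circDist]
  rcases succ_mod_eq hb h with h | h <;> omega

theorem tdist_adj {n : ℕ} {u v w : Vertex n} (h : (torus n).Adj u v) :
    tdist u w ≤ tdist v w + 1 := by
  obtain ⟨-, (⟨h₁, h₂⟩ | ⟨h₁, h₂⟩) | (⟨h₁, h₂⟩ | ⟨h₁, h₂⟩)⟩ := torus_adj.1 h
  · have := circDist_succ w.2 h₂
    simp only [tdist, h₁]
    omega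
  · have := circDist_succ w.1 h₁
    simp only [tdist, h₂]
    omega
  · have := circDist_succ w.2 h₂
    simp only [tdist, h₁]
    omega
  · have := circDist_succ w.1 h₁
    simp only [tdist, h₂]
    omega

theorem circDist_step {n : ℕ} (x z : Fin n) (h : circDist n x z ≠ 0) :
    ∃ y : Fin n, x ≠ y ∧ circDist n x z = circDist n y z + 1 ∧
      ((y : ℕ) = ((x : ℕ) + 1) % n ∨ (x : ℕ) = ((y : ℕ) + 1) % n) := by
  have hx := x.2
  have hz := z.2
  have up : ∃ y : Fin n, (y : ℕ) = ((x : ℕ) + 1) % n := ⟨⟨_, Nat.mod_lt _ (by omega)⟩, rfl⟩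
  have down : ∃ y : Fin n, (x : ℕ) = ((y : ℕ) + 1) % n := by
    rcases Nat.eq_zero_or_pos (x : ℕ) with h0 | h0
    · refine ⟨⟨n - 1, by omega⟩, ?_⟩
      simp only [Nat.sub_add_cancel (show 1 ≤ n by omega), Nat.mod_self, h0]
    · refine ⟨⟨x - 1, by omega⟩, ?_⟩
      simp only [Nat.sub_add_cancel h0, Nat.mod_eq_of_lt hx]
  obtain ⟨p, hp⟩ := up
  obtain ⟨q, hq⟩ := down
  have hp' := p.2
  have hq' := q.2
  have e₁ := succ_mod_eq hx hp
  have e₂ := succ_mod_eq hq' hq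
  have : circDist n x z = circDist n p z + 1 ∨ circDist n x z = circDist n q z + 1 := by
    simp only [circDist] at h ⊢
    omega
  rcases this with h' | h'
  · exact ⟨p, by rintro rfl; omega, h', .inl hp⟩
  · exact ⟨q, by rintro rfl; omega, h', .inr hq⟩

theorem tdist_step {n : ℕ} (u w : Vertex n) (h : tdist u w ≠ 0) :
    ∃ v, (torus n).Adj u v ∧ tdist u w = tdist v w + 1 := by
  by_cases h₁ : circDist n u.1 w.1 = 0
  · have h₂ : circDist n u.2 w.2 ≠ 0 := fun h₂ => h (by simp [tdist, h₁, h₂])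
    obtain ⟨y, hne, hy, hs⟩ := circDist_step _ _ h₂
    refine ⟨(u.1, y), torus_adj.2 ⟨fun e => hne (congrArg Prod.snd e), ?_⟩, ?_⟩
    · rcases hs with hs | hs
      · exact .inl (.inl ⟨rfl, hs⟩)
      · exact .inr (.inl ⟨rfl, hs⟩)
    · simp only [tdist]
      omega
  · obtain ⟨y, hne, hy, hs⟩ := circDist_step _ _ h₁
    refine ⟨(y, u.2), torus_adj.2 ⟨fun e => hne (congrArg Prod.fst e), ?_⟩, ?_⟩
    · rcases hs with hs | hs
      · exact .inl (.inr ⟨hs, rfl⟩)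
      · exact .inr (.inr ⟨hs, rfl⟩)
    · simp only [tdist]
      omega

theorem tdist_self {n : ℕ} (u : Vertex n) : tdist u u = 0 := by
  simp [tdist, circDist]

theorem exists_walk {n : ℕ} (k : ℕ) (u w : Vertex n) (h : tdist u w = k) :
    ∃ p : (torus n).Walk u w, p.length = k := by
  induction k generalizing u with
  | zero =>
    obtain rfl : u = w := by
      by_contra hne
      obtain ⟨u₁, u₂⟩ := u
      obtain ⟨v₁, v₂⟩ := w
      simp only [Prod.mk.injEq, Fin.ext_iff] at hne
      have := u₁.2
      have := u₂.2
      have := v₁.2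
      have := v₂.2
      simp only [tdist, circDist] at h
      omega
    exact ⟨.nil, rfl⟩
  | succ k ih =>
    obtain ⟨v, hv, hd⟩ := tdist_step u w (by omega)
    obtain ⟨p, hp⟩ := ih v (by omega)
    exact ⟨.cons hv p, by simp [hp]⟩

theorem tdist_le_length {n : ℕ} {u w : Vertex n} (p : (torus n).Walk u w) :
    tdist u w ≤ p.length := by
  induction p with
  | nil => simp [tdist_self]
  | cons h p ih =>
    rw [SimpleGraph.Walk.length_cons]
    exact (tdist_adj h).trans (Nat.add_le_add_right ih 1)

/-- The formula `tdist` is the distance in the torus. -/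
theorem torus_dist_eq {n : ℕ} (u w : Vertex n) : (torus n).dist u w = tdist u w := by
  obtain ⟨p, hp⟩ := exists_walk _ u w rfl
  obtain ⟨q, hq⟩ := SimpleGraph.Reachable.exists_walk_length_eq_dist ⟨p⟩
  exact le_antisymm (hp ▸ SimpleGraph.dist_le p) (hq ▸ tdist_le_length q)

theorem tdist_pos {n : ℕ} {u v : Vertex n} (h : v ≠ u) : 0 < tdist u v := by
  obtain ⟨u₁, u₂⟩ := u
  obtain ⟨v₁, v₂⟩ := v
  simp only [ne_eq, Prod.mk.injEq, Fin.ext_iff] at h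
  have := u₁.2
  have := u₂.2
  have := v₁.2
  have := v₂.2
  simp only [tdist, circDist]
  omega

/-- The choice of a vertex is a genuine random choice. -/
theorem isProbabilityMeasure_choiceLaw {n : ℕ} (hn : 2 ≤ n) (u : Vertex n) :
    IsProbabilityMeasure (choiceLaw u) := by
  have hpos : ∀ w ∈ Finset.univ.erase u, 0 < ((tdist u w : ℝ) ^ 2)⁻¹ := fun w hw => by
    have := tdist_pos (Finset.ne_of_mem_erase hw)
    positivity
  have hne : (Finset.univ.erase u).Nonempty := by
    rw [← Finset.card_pos, Finset.card_erase_of_mem (Finset.mem_univ u), Finset.card_univ]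
    simp only [Fintype.card_prod, Fintype.card_fin]
    have : 2 * 2 ≤ n * n := Nat.mul_le_mul hn hn
    omega
  have hS := Finset.sum_pos hpos hne
  constructor
  simp only [choiceLaw, Measure.coe_finsetSum, Finset.sum_apply, Measure.smul_apply,
    measure_univ, smul_eq_mul, mul_one]
  rw [← ENNReal.ofReal_sum_of_nonneg, ← Finset.mul_sum, normFactor, inv_mul_cancel₀ hS.ne',
    ENNReal.ofReal_one]
  intro w hw
  exact mul_nonneg (inv_nonneg.2 hS.le) (hpos w hw).le

end UTSW

/-!
For `n ≥ 3`, a vertex `u` of the torus is the centre of four unit squares, which form a wheel of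
four-cycles whose spokes are the four torus edges at `u`. The search keeps each of these cycles in
one of its two directions, and on the four of them pattern recognition has no real freedom: from
whatever cycle it starts, it walks once around the wheel and answers "true"
(`IsWheel.patternRecognition`). So the four torus edges at `u` are always collected. Every
collected edge lies in a four-cycle through `u`; hence `u` can only fail to be detected if some
four-cycle of the graph contains a long-range edge at `u` (`exists_cycle_of_notMem_detected`), and
it remains to show that this is improbable.

Each edge of a four-cycle belongs to the torus or is the choice of one of its endpoints. For given
vertices and a given way in which each edge arises, the choices involved are made by distinct
vertices and so are independent, because a vertex cannot choose both of its neighbours in the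
cycle. A choice of `v` by `u` has probability `Z d(u,v)⁻²`, and torus edges have `d = 1`; so, `Z`
being at most one, a cycle `u, v, x, w` with a long-range edge `u v` has probability at most `Z`
times the product of the four inverse square distances (`choicesLaw_real_cycle_le`). The sum of
these products over `v, x, w` is bounded uniformly in `n` (`sum_weight_cycle_le`): the sum over
`v` of `d(u,v)⁻² d(v,x)⁻²` is `O(d(u,x)^(-3/2))`, likewise for the sum over `w`, and `d(u,x)⁻³` is
summable over the plane. Finally `Z` is at most of order `1 / log n`, since the inverse squares
are not summable over the plane (`tendsto_normBound`). Thus a vertex is undetected with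
probability `O(1 / log n)`, uniformly, and the expectation follows by linearity.
-/

namespace UTSW

/-! ### The four-cycles search -/

section Search

variable {V : Type*}

theorem mem_nbrs [Fintype V] {G : SimpleGraph V} {w x : V} : x ∈ nbrs G w ↔ G.Adj w x := by
  simp [nbrs]

theorem mem_recursiveSearch [Fintype V] [DecidableEq V] {G : SimpleGraph V} {u : V} {c : Cycle V} :
    c ∈ recursiveSearch G u ↔ c.1 = u ∧
      (G.Adj u c.2.1 ∧ G.Adj c.2.1 c.2.2.1 ∧ G.Adj c.2.2.1 c.2.2.2 ∧ G.Adj c.2.2.2 u) ∧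
      c.2.2.1 ≠ u ∧ c.2.2.2 ≠ c.2.1 := by
  obtain ⟨a, v₂, v₃, v₄⟩ := c
  simp only [recursiveSearch, Finset.mem_biUnion, Finset.mem_sdiff, Finset.mem_insert,
    Finset.mem_singleton, not_or, mem_nbrs]
  constructor
  · rintro ⟨w₂, ⟨h₂, -⟩, w₃, ⟨h₃, h₃', -⟩, w₄, ⟨h₄, -, h₄', -⟩, h⟩
    split_ifs at h with h₁
    · simp only [Finset.mem_singleton, Prod.mk.injEq] at h
      obtain ⟨rfl, rfl, rfl, rfl⟩ := h
      exact ⟨rfl, ⟨h₂, h₃, h₄, mem_nbrs.1 h₁⟩, h₃', h₄'⟩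
    · simp at h
  · rintro ⟨rfl, ⟨h₂, h₃, h₄, h₁⟩, h₃', h₄'⟩
    refine ⟨v₂, ⟨h₂, h₂.ne'⟩, v₃, ⟨h₃, h₃', h₃.ne'⟩, v₄, ⟨h₄, h₁.ne, h₄', h₄.ne'⟩, ?_⟩
    rw [if_pos (mem_nbrs.2 h₁), Finset.mem_singleton]

theorem subset_foldl_keep [DecidableEq V] (l : List (Cycle V)) (R : Finset (Cycle V)) :
    R ⊆ l.foldl keepUnlessReversed R := by
  induction l generalizing R with
  | nil => simp
  | cons c l ih =>
    have h : R ⊆ keepUnlessReversed R c := by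
      rw [keepUnlessReversed]
      split_ifs
      · exact Finset.Subset.refl _
      · exact Finset.subset_insert _ _
    exact h.trans (ih _)

theorem mem_foldl_keep [DecidableEq V] (l : List (Cycle V)) (R : Finset (Cycle V))
    {c : Cycle V} (hc : c ∈ l) :
    c ∈ l.foldl keepUnlessReversed R ∨
      (c.1, c.2.2.2, c.2.2.1, c.2.1) ∈ l.foldl keepUnlessReversed R := by
  induction l generalizing R with
  | nil => simp at hc
  | cons d l ih =>
    rcases List.mem_cons.1 hc with rfl | hc
    · rw [List.foldl_cons]
      by_cases h : (c.1, c.2.2.2, c.2.2.1, c.2.1) ∈ R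
      · refine .inr (subset_foldl_keep _ _ ?_)
        rw [keepUnlessReversed, if_neg (not_not.2 h)]
        exact h
      · refine .inl (subset_foldl_keep _ _ ?_)
        rw [keepUnlessReversed, if_pos h]
        exact Finset.mem_insert_self _ _
    · exact ih _ hc

theorem FourCyclesSearch.subset [Fintype V] [DecidableEq V] {G : SimpleGraph V} {u : V}
    {L : Finset (Cycle V)}
    (h : FourCyclesSearch G u L) : L ⊆ recursiveSearch G u := by
  obtain ⟨l, -, hl, rfl⟩ := h
  simpa [hl] using foldl_keep_subset l ∅

theorem FourCyclesSearch.mem_or_reverse_mem [Fintype V] [DecidableEq V] {G : SimpleGraph V}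
    {u : V} {L : Finset (Cycle V)} (h : FourCyclesSearch G u L) {c : Cycle V}
    (hc : c ∈ recursiveSearch G u) :
    c ∈ L ∨ (c.1, c.2.2.2, c.2.2.1, c.2.1) ∈ L := by
  obtain ⟨l, -, hl, rfl⟩ := h
  exact mem_foldl_keep l ∅ (by rwa [← List.mem_toFinset, hl])

/-! ### Pattern recognition on a wheel -/

/-- The cycle `c` traverses, in one direction or the other, the cell with root `u`, neighbours
`a`, `b` of the root, and opposite corner `x`. -/
def IsCell (u a x b : V) (c : Cycle V) : Prop :=
  c = (u, a, x, b) ∨ c = (u, b, x, a)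

theorem IsCell.symm {u a x b : V} {c : Cycle V} (h : IsCell u a x b c) : IsCell u b x a c :=
  Or.symm h

/-- Four cells arranged cyclically around `u`: the cell `i` has the spokes `N i`, `N (i + 1)` and
the corner `X i`, and `c i` is a cycle traversing it. The indices are taken modulo four. -/
structure IsWheel (u : V) (N X : Fin 4 → V) (c : Fin 4 → Cycle V) : Prop where
  spoke_injective : Function.Injective N
  corner_injective : Function.Injective X
  spoke_ne_corner : ∀ i j, N i ≠ X j
  spoke_ne : ∀ i, N i ≠ u
  corner_ne : ∀ i, X i ≠ u
  isCell : ∀ i, IsCell u (N i) (X i) (N (i + 1)) (c i)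

namespace IsWheel

variable {u : V} {N X : Fin 4 → V} {c : Fin 4 → Cycle V}

theorem rotate (h : IsWheel u N X c) (j : Fin 4) :
    IsWheel u (fun i => N (j + i)) (fun i => X (j + i)) (fun i => c (j + i)) where
  spoke_injective := h.spoke_injective.comp (add_right_injective j)
  corner_injective := h.corner_injective.comp (add_right_injective j)
  spoke_ne_corner _ _ := h.spoke_ne_corner _ _
  spoke_ne _ := h.spoke_ne _
  corner_ne _ := h.corner_ne _
  isCell i := by simpa only [add_assoc] using h.isCell (j + i)

theorem reflect (h : IsWheel u N X c) (j : Fin 4) :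
    IsWheel u (fun i => N (j + 1 - i)) (fun i => X (j - i)) (fun i => c (j - i)) where
  spoke_injective := h.spoke_injective.comp sub_right_injective
  corner_injective := h.corner_injective.comp sub_right_injective
  spoke_ne_corner _ _ := h.spoke_ne_corner _ _
  spoke_ne _ := h.spoke_ne _
  corner_ne _ := h.corner_ne _
  isCell i := by
    have := (h.isCell (j - i)).symm
    rwa [show j - i + 1 = j + 1 - i by abel,
      show j - i = j + 1 - (i + 1) by abel, add_sub_add_right_eq_sub] at *

theorem corner_eq (h : IsWheel u N X c) (i : Fin 4) : (c i).2.2.1 = X i := by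
  rcases h.isCell i with h | h <;> rw [h]

theorem cycle_injective (h : IsWheel u N X c) : Function.Injective c := fun i j hij =>
  h.corner_injective (by rw [← h.corner_eq, ← h.corner_eq, hij])

/-- The spoke `N i` only belongs to the cells `i` and `i - 1`. -/
theorem eq_or_eq_of_mem (h : IsWheel u N X c) {i j : Fin 4}
    (hj : (c j).2.1 = N i ∨ (c j).2.2.2 = N i) : j = i ∨ j + 1 = i := by
  rcases h.isCell j with e | e <;> rw [e] at hj <;> rcases hj with hj | hj <;>
    have := h.spoke_injective hj <;> tauto

end IsWheel

/-- If exactly one remaining cycle contains the current vertex, then an iteration of the main loop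
is forced to use it. -/
theorem PatternLoop.step [DecidableEq V] {t : V} {k : ℕ} {C : Finset (Cycle V)} {S : Finset V}
    {r : Bool} {u a x b : V} {d : Cycle V} (h : PatternLoop t (k + 1) C S a r) (hd : d ∈ C)
    (hcell : IsCell u a x b d) (huniq : ∀ e ∈ C, e.2.1 = a ∨ e.2.2.2 = a → e = d)
    (hab : a ≠ b) (hx : x ∉ S) (hb : b ∉ S) :
    PatternLoop t k (C.erase d) (S ∪ {a, x, b}) b r := by
  have hcover : ({d.2.1, d.2.2.1, d.2.2.2} : Finset V) = {a, x, b} := by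
    rcases hcell with rfl | rfl <;> ext y <;> simp only [Finset.mem_insert, Finset.mem_singleton]
    tauto
  have hends : ({d.2.1, d.2.2.2} : Finset V) = {a, b} := by
    rcases hcell with rfl | rfl
    · rfl
    · exact Finset.pair_comm _ _
  have hroot : d.2.1 = a ∨ d.2.2.2 = a := by
    rcases hcell with rfl | rfl <;> simp
  cases h with
  | notFound _ _ _ _ h => exact absurd hroot (h d hd)
  | clash _ _ _ _ e he hea h =>
    obtain rfl := huniq e he hea
    refine absurd ?_ h
    rw [hcover]
    ext y
    simp only [Finset.mem_inter, Finset.mem_sdiff, Finset.mem_insert, Finset.mem_singleton,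
      Finset.notMem_empty, iff_false]
    rintro ⟨⟨rfl | rfl | rfl, hya⟩, hyS⟩
    · exact hya rfl
    · exact hx hyS
    · exact hb hyS
  | next _ _ _ _ e he hea _ a' ha' _ hr =>
    obtain rfl := huniq e he hea
    rw [hends] at ha'
    obtain rfl : a' = b := by
      simp only [Finset.mem_sdiff, Finset.mem_insert, Finset.mem_singleton] at ha'
      tauto
    rwa [hcover] at hr

/-- The main loop, started after removing the cell `0` traversed from `N 0` to `N 1`, goes once
around the wheel and comes back to `N 0`. -/
theorem IsWheel.patternLoop [DecidableEq V] {u : V} {N X : Fin 4 → V} {c : Fin 4 → Cycle V}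
    (h : IsWheel u N X c) {r : Bool}
    (hr : PatternLoop (N 0) 3 ((Finset.univ.image c).erase (c 0)) {u, X 0, N 1} (N 1) r) :
    r = true := by
  have hc : ∀ {i j}, c i = c j ↔ i = j := h.cycle_injective.eq_iff
  have hN : ∀ {i j}, N i = N j ↔ i = j := h.spoke_injective.eq_iff
  have hX : ∀ {i j}, X i = X j ↔ i = j := h.corner_injective.eq_iff
  have hNX := h.spoke_ne_corner
  have hXN := fun i j => (h.spoke_ne_corner j i).symm
  have hNu := h.spoke_ne
  have hXu := h.corner_ne
  have huniq : ∀ (i : Fin 4) (C : Finset (Cycle V)), C ⊆ Finset.univ.image c →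
      c (i - 1) ∉ C → ∀ e ∈ C, e.2.1 = N i ∨ e.2.2.2 = N i → e = c i := by
    intro i C hC hi e he hei
    obtain ⟨j, -, rfl⟩ := Finset.mem_image.1 (hC he)
    rcases h.eq_or_eq_of_mem hei with rfl | rfl
    · rfl
    · rw [add_sub_cancel_right] at hi
      exact absurd he hi
  have s₁ := hr.step (by simp [hc]) (h.isCell 1)
    (huniq 1 _ (Finset.erase_subset _ _) (by simp))
    (by simp [hN]) (by simp [hX, hXN, hXu]) (by simp [hN, hNX, hNu])
  have s₂ := s₁.step (by simp [hc]) (h.isCell 2)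
    (huniq 2 _ ((Finset.erase_subset _ _).trans (Finset.erase_subset _ _))
      (by rw [show (2 : Fin 4) - 1 = 1 from rfl]; simp))
    (by simp [hN]) (by simp [hX, hXN, hXu]) (by simp [hN, hNX, hNu])
  have s₃ := s₂.step (by simp [hc]) (h.isCell 3)
    (huniq 3 _ ((Finset.erase_subset _ _).trans
      ((Finset.erase_subset _ _).trans (Finset.erase_subset _ _)))
      (by rw [show (3 : Fin 4) - 1 = 2 from rfl]; simp))
    (by simp [hN]) (by simp [hX, hXN, hXu]) (by simp [hN, hNX, hNu])
  cases s₃ with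
  | finish => simp

/-- On the four cells of a wheel the pattern recognition answers "true", whatever cycle it starts
from. -/
theorem IsWheel.patternRecognition [DecidableEq V] {u : V} {N X : Fin 4 → V} {c : Fin 4 → Cycle V}
    (h : IsWheel u N X c) {r : Bool} (hr : PatternRecognition (Finset.univ.image c) r) :
    r = true := by
  obtain ⟨d, hd, hr⟩ := hr
  obtain ⟨j, -, rfl⟩ := Finset.mem_image.1 hd
  -- Relabel the wheel so that the starting cell is traversed from the spoke `0` to the spoke `1`.
  rcases h.isCell j with e | e
  · have himage : Finset.univ.image (fun i => c (j + i)) = Finset.univ.image c := by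
      ext x
      simp only [Finset.mem_image, Finset.mem_univ, true_and]
      exact ⟨fun ⟨i, hi⟩ => ⟨_, hi⟩, fun ⟨i, hi⟩ => ⟨i - j, by simpa using hi⟩⟩
    refine (h.rotate j).patternLoop ?_
    simp only [himage, add_zero]
    simpa only [e] using hr
  · have himage : Finset.univ.image (fun i => c (j - i)) = Finset.univ.image c := by
      ext x
      simp only [Finset.mem_image, Finset.mem_univ, true_and]
      exact ⟨fun ⟨i, hi⟩ => ⟨_, hi⟩, fun ⟨i, hi⟩ => ⟨j - i, by simpa using hi⟩⟩
    refine (h.reflect j).patternLoop ?_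
    simp only [himage, sub_zero, add_sub_cancel_right]
    simpa only [e] using hr

/-! ### Detection of vertices whose long-range edges lie in no four-cycle -/

/-- In every run, a vertex `u` is detected if it is the centre of a wheel of four-cycles of `G`, and
if every four-cycle through `u` leaves `u` by a spoke of this wheel. -/
theorem LRERARun.mem_detected [Fintype V] [DecidableEq V] {G : SimpleGraph V} (run : LRERARun G)
    {u : V} {N X : Fin 4 → V}
    (h : IsWheel u N X fun i => (u, N i, X i, N (i + 1)))
    (hN : ∀ i, G.Adj u (N i)) (hX : ∀ i, G.Adj (N i) (X i)) (hX' : ∀ i, G.Adj (X i) (N (i + 1)))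
    (hspoke : ∀ v x w, G.Adj u v → G.Adj v x → G.Adj x w → G.Adj w u → x ≠ u → w ≠ v →
      ∃ i, v = N i) :
    u ∈ run.detected := by
  have hcell : ∀ i, ∃ c ∈ run.cycles u, IsCell u (N i) (X i) (N (i + 1)) c := by
    intro i
    have hmem : (u, N i, X i, N (i + 1)) ∈ recursiveSearch G u :=
      mem_recursiveSearch.2 ⟨rfl, ⟨hN _, hX _, hX' _, (hN _).symm⟩, h.corner_ne i,
        h.spoke_injective.ne (by simp)⟩
    rcases (run.cycles_spec u).mem_or_reverse_mem hmem with hc | hc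
    · exact ⟨_, hc, .inl rfl⟩
    · exact ⟨_, hc, .inr rfl⟩
  choose c hc hcell using hcell
  have hwheel : IsWheel u N X c := { h with isCell := hcell }
  have hC : Finset.univ.image c ∈ (run.cycles u).powersetCard 4 := by
    refine Finset.mem_powersetCard.2 ⟨fun d hd => ?_, ?_⟩
    · obtain ⟨i, -, rfl⟩ := Finset.mem_image.1 hd
      exact hc i
    · rw [Finset.card_image_of_injective _ hwheel.cycle_injective]
      rfl
  have hanswer := hwheel.patternRecognition (run.answer_spec u _ hC)
  have hcollected : run.collected u = Finset.univ.image fun i => s(u, N i) := by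
    ext e
    simp only [LRERARun.collected, Finset.mem_biUnion, Finset.mem_filter, Finset.mem_image,
      Finset.mem_univ, true_and]
    constructor
    · rintro ⟨C, ⟨hC, -⟩, ⟨d, hd, he⟩, hue⟩
      obtain ⟨h₁, ⟨h₂, h₃, h₄, h₅⟩, h₆, h₇⟩ := mem_recursiveSearch.1
        ((run.cycles_spec u).subset ((Finset.mem_powersetCard.1 hC).1 hd))
      simp only [cycleEdges, Finset.mem_insert, Finset.mem_singleton] at he
      rcases he with rfl | rfl | rfl | rfl
      · obtain ⟨i, hi⟩ := hspoke _ _ _ h₂ h₃ h₄ h₅ h₆ h₇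
        exact ⟨i, by rw [h₁, hi]⟩
      · rcases Sym2.mem_iff.1 hue with e | e
        · exact absurd e h₂.ne
        · exact absurd e.symm h₆
      · rcases Sym2.mem_iff.1 hue with e | e
        · exact absurd e.symm h₆
        · exact absurd e h₅.ne'
      · obtain ⟨i, hi⟩ := hspoke _ _ _ h₅.symm h₄.symm h₃.symm h₂.symm h₆ h₇.symm
        exact ⟨i, by rw [h₁, hi, Sym2.eq_swap]⟩
    · rintro ⟨i, rfl⟩
      refine ⟨_, ⟨hC, hanswer⟩, ⟨c i, Finset.mem_image_of_mem _ (Finset.mem_univ i), ?_⟩,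
        Sym2.mem_mk_left _ _⟩
      rcases hcell i with e | e <;> rw [e] <;> simp [cycleEdges]
  rw [LRERARun.detected, Finset.mem_filter, hcollected, Finset.card_image_of_injective]
  · exact ⟨Finset.mem_univ _, rfl⟩
  · intro i j hij
    exact h.spoke_injective (Sym2.congr_right.1 hij)

end Search

/-! ### The wheels of the torus -/

theorem exists_succ_pred {n : ℕ} (hn : 3 ≤ n) (x : Fin n) :
    ∃ p q : Fin n, p ≠ x ∧ q ≠ x ∧ p ≠ q ∧ (p : ℕ) = ((x : ℕ) + 1) % n ∧
      (x : ℕ) = ((q : ℕ) + 1) % n ∧ ∀ y : Fin n, (x : ℕ) = ((y : ℕ) + 1) % n → y = q := by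
  have hx := x.2
  obtain ⟨p, hp⟩ : ∃ y : Fin n, (y : ℕ) = ((x : ℕ) + 1) % n :=
    ⟨⟨_, Nat.mod_lt _ (by omega)⟩, rfl⟩
  obtain ⟨q, hq⟩ : ∃ y : Fin n, (x : ℕ) = ((y : ℕ) + 1) % n := by
    rcases Nat.eq_zero_or_pos (x : ℕ) with h0 | h0
    · refine ⟨⟨n - 1, by omega⟩, ?_⟩
      simp only [Nat.sub_add_cancel (show 1 ≤ n by omega), Nat.mod_self, h0]
    · refine ⟨⟨x - 1, by omega⟩, ?_⟩
      simp only [Nat.sub_add_cancel h0, Nat.mod_eq_of_lt hx]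
  have hq' := q.2
  have e₁ := succ_mod_eq hx hp
  have e₂ := succ_mod_eq hq' hq
  refine ⟨p, q, ?_, ?_, ?_, hp, hq, fun y hy => ?_⟩
  · rw [ne_eq, Fin.ext_iff]; omega
  · rw [ne_eq, Fin.ext_iff]; omega
  · rw [ne_eq, Fin.ext_iff]; omega
  · have hy' := y.2
    have e₃ := succ_mod_eq hy' hy
    rw [Fin.ext_iff]; omega

/-- For `n ≥ 3` the four unit squares at a vertex `u` of the torus form a wheel, and its spokes
lead to all the neighbours of `u`. -/
theorem exists_torus_wheel {n : ℕ} (hn : 3 ≤ n) (u : Vertex n) :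
    ∃ N X : Fin 4 → Vertex n, IsWheel u N X (fun i => (u, N i, X i, N (i + 1))) ∧
      (∀ i, (torus n).Adj u (N i)) ∧ (∀ i, (torus n).Adj (N i) (X i)) ∧
      (∀ i, (torus n).Adj (X i) (N (i + 1))) ∧ ∀ v, (torus n).Adj u v → ∃ i, v = N i := by
  obtain ⟨x, y⟩ := u
  obtain ⟨p, q, hp, hq, hpq, ep, dq, uq⟩ := exists_succ_pred hn x
  obtain ⟨p', q', hp', hq', hpq', ep', dq', uq'⟩ := exists_succ_pred hn y
  refine ⟨![(p, y), (x, p'), (q, y), (x, q')], ![(p, p'), (q, p'), (q, q'), (p, q')],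
    ⟨?_, ?_, ?_, ?_, ?_, fun i => .inl rfl⟩, ?_, ?_, ?_, ?_⟩
  · intro i j
    fin_cases i <;> fin_cases j <;> simp [hp, hq, hpq, hp', hq', hpq', hp.symm, hq.symm, hpq.symm,
      hp'.symm, hq'.symm, hpq'.symm]
  · intro i j
    fin_cases i <;> fin_cases j <;> simp [hpq, hpq', hpq.symm, hpq'.symm]
  · intro i j
    fin_cases i <;> fin_cases j <;> simp [hp.symm, hq.symm, hp'.symm, hq'.symm]
  · intro i
    fin_cases i <;> simp [hp, hq, hp', hq']
  · intro i
    fin_cases i <;> simp [hp, hq]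
  · intro i
    rw [torus_adj]
    fin_cases i <;> simp [← ep, ← dq, ← ep', ← dq', hp.symm, hq.symm, hp'.symm, hq'.symm]
  · intro i
    rw [torus_adj]
    fin_cases i <;> simp [← ep, ← dq, ← ep', ← dq', hp.symm, hq.symm, hp'.symm, hq'.symm]
  · intro i
    rw [torus_adj]
    fin_cases i <;> simp [← ep, ← dq, ← ep', ← dq', hp, hq, hp', hq']
  · intro v hv
    obtain ⟨v, w⟩ := v
    obtain ⟨-, (⟨h₁, h₂⟩ | ⟨h₁, h₂⟩) | (⟨h₁, h₂⟩ | ⟨h₁, h₂⟩)⟩ := torus_adj.1 hv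
    · exact ⟨1, Prod.ext h₁ (Fin.ext (h₂.trans ep'.symm))⟩
    · exact ⟨0, Prod.ext (Fin.ext (h₁.trans ep.symm)) h₂⟩
    · exact ⟨3, Prod.ext h₁.symm (uq' _ h₂)⟩
    · exact ⟨2, Prod.ext (uq _ h₁) h₂.symm⟩

/-- An undetected vertex has a long-range edge lying in a four-cycle of the graph. -/
theorem exists_cycle_of_notMem_detected {n : ℕ} (hn : 3 ≤ n) {ω : Choices n}
    (run : LRERARun (graph ω)) {u : Vertex n} (hu : u ∉ run.detected) :
    ∃ v x w, (graph ω).Adj u v ∧ (graph ω).Adj v x ∧ (graph ω).Adj x w ∧ (graph ω).Adj w u ∧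
      x ≠ u ∧ w ≠ v ∧ ¬ (torus n).Adj u v := by
  by_contra! hcon
  obtain ⟨N, X, hwheel, hN, hX, hX', hall⟩ := exists_torus_wheel hn u
  have hle : torus n ≤ graph ω := le_sup_left
  exact hu (run.mem_detected hwheel (fun i => hle (hN i)) (fun i => hle (hX i))
    (fun i => hle (hX' i)) fun v x w h₁ h₂ h₃ h₄ h₅ h₆ => hall v (hcon v x w h₁ h₂ h₃ h₄ h₅ h₆))

/-! ### Sums over the torus -/

theorem tdist_comm {n : ℕ} (u v : Vertex n) : tdist u v = tdist v u := by
  rw [← torus_dist_eq, ← torus_dist_eq, SimpleGraph.dist_comm]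

theorem tdist_triangle {n : ℕ} (u v w : Vertex n) : tdist u w ≤ tdist u v + tdist v w := by
  obtain ⟨p, hp⟩ := exists_walk _ u v rfl
  obtain ⟨q, hq⟩ := exists_walk _ v w rfl
  rw [← hp, ← hq, ← SimpleGraph.Walk.length_append]
  exact tdist_le_length _

theorem tdist_eq_one {n : ℕ} {u v : Vertex n} (h : (torus n).Adj u v) : tdist u v = 1 := by
  have h₁ := tdist_adj (w := v) h
  have h₂ := tdist_pos h.ne'
  rw [tdist_self] at h₁
  omega

/-- On a sphere of radius `k` around `u` a vertex `w` is determined by the circular distance of its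
first coordinate from that of `u` and by the sides of `u` on which its two coordinates lie. -/
theorem card_sphere_le {n : ℕ} (u : Vertex n) (k : ℕ) :
    (Finset.univ.filter fun w => tdist u w = k).card ≤ 4 * (k + 1) := by
  let side : Fin n → Fin n → Bool := fun x y =>
    decide (if (x : ℕ) ≤ y then 2 * ((y : ℕ) - x) ≤ n else 2 * ((y : ℕ) + n - x) ≤ n)
  have hside : ∀ x y z : Fin n, circDist n x y = circDist n x z → side x y = side x z → y = z := by
    intro x y z h₁ h₂
    have hx := x.2
    have hy := y.2
    have hz := z.2
    simp only [side, decide_eq_decide] at h₂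
    simp only [circDist] at h₁
    rw [Fin.ext_iff]
    split_ifs at h₂ <;> omega
  calc (Finset.univ.filter fun w => tdist u w = k).card
      ≤ (Finset.range (k + 1) ×ˢ (Finset.univ : Finset (Bool × Bool))).card := by
        refine Finset.card_le_card_of_injOn
          (fun w => (circDist n u.1 w.1, side u.1 w.1, side u.2 w.2)) ?_ ?_
        · intro w hw
          have hw' : circDist n u.1 w.1 + circDist n u.2 w.2 = k := (Finset.mem_filter.1 hw).2
          simp
          omega
        · intro v hv w hw h
          have hv' : circDist n u.1 v.1 + circDist n u.2 v.2 = k := (Finset.mem_filter.1 hv).2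
          have hw' : circDist n u.1 w.1 + circDist n u.2 w.2 = k := (Finset.mem_filter.1 hw).2
          simp only [Prod.mk.injEq] at h
          obtain ⟨h₁, h₂, h₃⟩ := h
          exact Prod.ext (hside _ _ _ h₁ h₂) (hside _ _ _ (by omega) h₃)
    _ = 4 * (k + 1) := by simp [mul_comm]

/-- A bound, uniform in `n`, of the sum of `d(u,w)^(-5/2)` over the torus. It exists because the
exponent `5/2` exceeds the dimension two. -/
noncomputable def decayConst : ℝ := 8 * ∑' k : ℕ, (k : ℝ) ^ (-(3 / 2) : ℝ)

theorem decayConst_nonneg : 0 ≤ decayConst :=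
  mul_nonneg (by norm_num) (tsum_nonneg fun _ => by positivity)

theorem sum_rpow_tdist_le {n : ℕ} (u : Vertex n) :
    ∑ w, (tdist u w : ℝ) ^ (-(5 / 2) : ℝ) ≤ decayConst := by
  have hterm : ∀ k : ℕ, ((4 * (k + 1) : ℕ) : ℝ) * (k : ℝ) ^ (-(5 / 2) : ℝ) ≤
      8 * (k : ℝ) ^ (-(3 / 2) : ℝ) := by
    intro k
    rcases Nat.eq_zero_or_pos k with rfl | hk
    · norm_num
    · have hk' : (1 : ℝ) ≤ k := by exact_mod_cast hk
      have hsplit : (k : ℝ) ^ (-(3 / 2) : ℝ) = k * (k : ℝ) ^ (-(5 / 2) : ℝ) := by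
        rw [← Real.rpow_one_add' (by positivity) (by norm_num)]
        norm_num
      rw [hsplit, ← mul_assoc]
      refine mul_le_mul_of_nonneg_right ?_ (by positivity)
      push_cast
      linarith
  have hsum : Summable fun k : ℕ => (k : ℝ) ^ (-(3 / 2) : ℝ) :=
    Real.summable_nat_rpow.2 (by norm_num)
  let s := Finset.univ.image fun w => tdist u w
  calc ∑ w, (tdist u w : ℝ) ^ (-(5 / 2) : ℝ)
      = ∑ k ∈ s, ∑ w with tdist u w = k, (tdist u w : ℝ) ^ (-(5 / 2) : ℝ) :=
        (Finset.sum_fiberwise_of_maps_to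
          (fun w hw => Finset.mem_image_of_mem _ hw) _).symm
    _ ≤ ∑ k ∈ s, 8 * (k : ℝ) ^ (-(3 / 2) : ℝ) := by
        refine Finset.sum_le_sum fun k _ => ?_
        rw [Finset.sum_congr rfl fun w hw => by rw [(Finset.mem_filter.1 hw).2],
          Finset.sum_const, nsmul_eq_mul]
        refine le_trans (mul_le_mul_of_nonneg_right ?_ (by positivity)) (hterm k)
        exact_mod_cast card_sphere_le u k
    _ ≤ decayConst := by
        rw [← Finset.mul_sum]
        exact mul_le_mul_of_nonneg_left (hsum.sum_le_tsum _ fun _ _ => by positivity)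
          (by norm_num)

/-- The weight `d(u,v)⁻²`, equal to zero for `u = v`. -/
noncomputable def weight {n : ℕ} (u v : Vertex n) : ℝ := ((tdist u v : ℝ) ^ 2)⁻¹

theorem weight_nonneg {n : ℕ} (u v : Vertex n) : 0 ≤ weight u v := by
  unfold weight
  positivity

theorem weight_comm {n : ℕ} (u v : Vertex n) : weight u v = weight v u := by
  rw [weight, weight, tdist_comm]

theorem weight_eq_one {n : ℕ} {u v : Vertex n} (h : (torus n).Adj u v) : weight u v = 1 := by
  simp [weight, tdist_eq_one h]

/-- The larger of `a`, `b` is at least `D / 2`. Spending `3/2` of its exponent on `D` leaves, for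
the smaller one, an exponent that is summable over the torus. -/
theorem inv_sq_mul_inv_sq_le {a b D : ℝ} (ha : 0 < a) (hb : 0 < b) (hD : 0 < D)
    (h : D ≤ a + b) :
    (a ^ 2)⁻¹ * (b ^ 2)⁻¹ ≤
      4 * D ^ (-(3 / 2) : ℝ) * (a ^ (-(5 / 2) : ℝ) + b ^ (-(5 / 2) : ℝ)) := by
  wlog hab : a ≤ b generalizing a b
  · have := this hb ha (by linarith) (le_of_not_ge hab)
    rwa [mul_comm, add_comm]
  have e₁ : (a ^ 2)⁻¹ = a ^ (-(5 / 2) : ℝ) * a ^ (1 / 2 : ℝ) := by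
    rw [← Real.rpow_add ha, ← Real.rpow_natCast, ← Real.rpow_neg ha.le]
    norm_num
  have e₂ : (b ^ 2)⁻¹ = b ^ (-(3 / 2) : ℝ) * b ^ (-(1 / 2) : ℝ) := by
    rw [← Real.rpow_add hb, ← Real.rpow_natCast, ← Real.rpow_neg hb.le]
    norm_num
  have h₁ : a ^ (1 / 2 : ℝ) * b ^ (-(1 / 2) : ℝ) ≤ 1 := by
    rw [Real.rpow_neg hb.le, ← div_eq_mul_inv]
    exact div_le_one_of_le₀ (Real.rpow_le_rpow ha.le hab (by norm_num)) (by positivity)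
  have h₂ : b ^ (-(3 / 2) : ℝ) ≤ 4 * D ^ (-(3 / 2) : ℝ) := by
    have h₃ : (2 * b) ^ (-(3 / 2) : ℝ) ≤ D ^ (-(3 / 2) : ℝ) :=
      Real.rpow_le_rpow_of_nonpos hD (by linarith) (by norm_num)
    have h₄ : (4 : ℝ)⁻¹ ≤ 2 ^ (-(3 / 2) : ℝ) := by
      rw [show (4 : ℝ)⁻¹ = 2 ^ (-2 : ℝ) by norm_num [Real.rpow_neg]]
      exact Real.rpow_le_rpow_of_exponent_le (by norm_num) (by norm_num)
    rw [Real.mul_rpow (by norm_num) hb.le] at h₃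
    have h₅ : 0 < b ^ (-(3 / 2) : ℝ) := by positivity
    nlinarith
  calc (a ^ 2)⁻¹ * (b ^ 2)⁻¹
      = a ^ (-(5 / 2) : ℝ) * b ^ (-(3 / 2) : ℝ) * (a ^ (1 / 2 : ℝ) * b ^ (-(1 / 2) : ℝ)) := by
        rw [e₁, e₂]; ring
    _ ≤ a ^ (-(5 / 2) : ℝ) * (4 * D ^ (-(3 / 2) : ℝ)) * 1 := by gcongr
    _ ≤ 4 * D ^ (-(3 / 2) : ℝ) * (a ^ (-(5 / 2) : ℝ) + b ^ (-(5 / 2) : ℝ)) := by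
        have : 0 ≤ 4 * D ^ (-(3 / 2) : ℝ) * b ^ (-(5 / 2) : ℝ) := by positivity
        linarith

/-- Paths of length two: the convolution of the weight with itself decays faster than `1 / D`. -/
theorem sum_weight_mul_weight_le {n : ℕ} {u x : Vertex n} (hx : x ≠ u) :
    ∑ v, weight u v * weight v x ≤ 8 * decayConst * (tdist u x : ℝ) ^ (-(3 / 2) : ℝ) := by
  have hD : (0 : ℝ) < tdist u x := by exact_mod_cast tdist_pos hx
  calc ∑ v, weight u v * weight v x
      ≤ ∑ v, 4 * (tdist u x : ℝ) ^ (-(3 / 2) : ℝ) *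
          ((tdist u v : ℝ) ^ (-(5 / 2) : ℝ) + (tdist x v : ℝ) ^ (-(5 / 2) : ℝ)) := by
        refine Finset.sum_le_sum fun v _ => ?_
        rw [weight_comm v x]
        rcases eq_or_ne v u with rfl | hu
        · rw [weight, tdist_self]
          norm_num
          positivity
        rcases eq_or_ne v x with rfl | hv
        · rw [mul_comm, weight, tdist_self]
          norm_num
          positivity
        refine inv_sq_mul_inv_sq_le ?_ ?_ hD ?_
        · exact_mod_cast tdist_pos hu
        · exact_mod_cast tdist_pos hv
        · rw [tdist_comm x v]
          exact_mod_cast tdist_triangle u v x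
    _ ≤ 4 * (tdist u x : ℝ) ^ (-(3 / 2) : ℝ) * (decayConst + decayConst) := by
        rw [← Finset.mul_sum, Finset.sum_add_distrib]
        gcongr <;> exact sum_rpow_tdist_le _
    _ = 8 * decayConst * (tdist u x : ℝ) ^ (-(3 / 2) : ℝ) := by ring

/-- The total weight of the four-cycles through a vertex is bounded uniformly in `n`. -/
theorem sum_weight_cycle_le {n : ℕ} (u : Vertex n) :
    ∑ x ∈ Finset.univ.erase u, ∑ v, ∑ w, weight u v * weight v x * weight x w * weight w u ≤
      (8 * decayConst) ^ 2 * decayConst := by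
  have hA := decayConst_nonneg
  calc ∑ x ∈ Finset.univ.erase u, ∑ v, ∑ w, weight u v * weight v x * weight x w * weight w u
      = ∑ x ∈ Finset.univ.erase u, (∑ v, weight u v * weight v x) ^ 2 := by
        refine Finset.sum_congr rfl fun x _ => ?_
        rw [sq, Finset.sum_mul_sum]
        refine Finset.sum_congr rfl fun v _ => Finset.sum_congr rfl fun w _ => ?_
        rw [weight_comm w u, weight_comm x w]
        ring
    _ ≤ ∑ x ∈ Finset.univ.erase u, (8 * decayConst) ^ 2 * (tdist u x : ℝ) ^ (-(5 / 2) : ℝ) := by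
        refine Finset.sum_le_sum fun x hx => ?_
        have hne := Finset.ne_of_mem_erase hx
        have hD : (1 : ℝ) ≤ tdist u x := by exact_mod_cast tdist_pos hne
        calc (∑ v, weight u v * weight v x) ^ 2
            ≤ (8 * decayConst * (tdist u x : ℝ) ^ (-(3 / 2) : ℝ)) ^ 2 :=
              pow_le_pow_left₀ (Finset.sum_nonneg fun _ _ =>
                mul_nonneg (weight_nonneg _ _) (weight_nonneg _ _))
                (sum_weight_mul_weight_le hne) 2
          _ = (8 * decayConst) ^ 2 * (tdist u x : ℝ) ^ (-3 : ℝ) := by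
              rw [mul_pow, ← Real.rpow_natCast ((tdist u x : ℝ) ^ (-(3 / 2) : ℝ)),
                ← Real.rpow_mul (by positivity)]
              norm_num
          _ ≤ _ := by
              refine mul_le_mul_of_nonneg_left ?_ (sq_nonneg _)
              exact Real.rpow_le_rpow_of_exponent_le hD (by norm_num)
    _ ≤ ∑ x, (8 * decayConst) ^ 2 * (tdist u x : ℝ) ^ (-(5 / 2) : ℝ) :=
        Finset.sum_le_sum_of_subset_of_nonneg (Finset.erase_subset _ _)
          fun _ _ _ => by positivity
    _ ≤ (8 * decayConst) ^ 2 * decayConst := by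
        rw [← Finset.mul_sum]
        gcongr
        exact sum_rpow_tdist_le u

/-! ### The normalizing factor tends to zero -/

/-- An upper bound of the normalizing factors, of order `1 / log n`. -/
noncomputable def normBound (n : ℕ) : ℝ := 4 * (∑ i ∈ Finset.range n, (i : ℝ)⁻¹)⁻¹

theorem tendsto_normBound : Tendsto normBound atTop (𝓝 0) := by
  have h : Tendsto (fun n : ℕ => ∑ i ∈ Finset.range n, (i : ℝ)⁻¹) atTop atTop :=
    (not_summable_iff_tendsto_nat_atTop_of_nonneg fun _ => by positivity).1
      Real.not_summable_natCast_inv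
  have h' := h.inv_tendsto_atTop.const_mul 4
  rwa [mul_zero] at h'

theorem circDist_add_le {n : ℕ} [NeZero n] (x i : Fin n) : circDist n x (x + i) ≤ i := by
  have hx := x.2
  have hi := i.2
  simp only [circDist, Fin.val_add_eq_ite]
  split_ifs <;> omega

theorem normFactor_nonneg {n : ℕ} (u : Vertex n) : 0 ≤ normFactor u :=
  inv_nonneg.2 (Finset.sum_nonneg fun w _ => weight_nonneg u w)

/-- Compare the vertex `u + (i, j)` with `(i + j)⁻²`, and sum over `j < i`. -/
theorem normFactor_le {n : ℕ} (hn : 2 ≤ n) (u : Vertex n) : normFactor u ≤ normBound n := by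
  have : NeZero n := ⟨by omega⟩
  have hpos : 0 < ∑ i ∈ Finset.range n, (i : ℝ)⁻¹ :=
    Finset.sum_pos' (fun _ _ => by positivity) ⟨1, Finset.mem_range.2 (by omega), by norm_num⟩
  have hsum : (∑ i ∈ Finset.range n, (i : ℝ)⁻¹) / 4 ≤ ∑ w ∈ Finset.univ.erase u, weight u w := by
    calc (∑ i ∈ Finset.range n, (i : ℝ)⁻¹) / 4
        ≤ ∑ i ∈ Finset.range n, ∑ j ∈ Finset.range n, (((i : ℝ) + j) ^ 2)⁻¹ := by
          rw [Finset.sum_div]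
          refine Finset.sum_le_sum fun i hi => ?_
          rw [Finset.mem_range] at hi
          calc (i : ℝ)⁻¹ / 4 = ∑ j ∈ Finset.range i, (((i : ℝ) + i) ^ 2)⁻¹ := by
                rw [Finset.sum_const, Finset.card_range, nsmul_eq_mul]
                rcases Nat.eq_zero_or_pos i with rfl | h
                · simp
                · field_simp
                  norm_num
            _ ≤ ∑ j ∈ Finset.range i, (((i : ℝ) + j) ^ 2)⁻¹ := by
                refine Finset.sum_le_sum fun j hj => ?_
                have hj' : (j : ℝ) ≤ i := by exact_mod_cast (Finset.mem_range.1 hj).le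
                have hi' : (0 : ℝ) < i := by
                  exact_mod_cast (Nat.zero_le j).trans_lt (Finset.mem_range.1 hj)
                gcongr
            _ ≤ _ := Finset.sum_le_sum_of_subset_of_nonneg
                (Finset.range_subset_range.2 hi.le) fun _ _ _ => by positivity
      _ = ∑ o : Vertex n, (((o.1 : ℝ) + (o.2 : ℝ)) ^ 2)⁻¹ := by
          rw [Fintype.sum_prod_type, ← Fin.sum_univ_eq_sum_range
            (fun i => ∑ j ∈ Finset.range n, (((i : ℝ) + j) ^ 2)⁻¹)]
          refine Finset.sum_congr rfl fun i _ => ?_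
          rw [← Fin.sum_univ_eq_sum_range (fun j => ((((i : ℕ) : ℝ) + j) ^ 2)⁻¹)]
      _ ≤ ∑ o : Vertex n, weight u (u + o) := by
          refine Finset.sum_le_sum fun o _ => ?_
          rcases eq_or_ne (tdist u (u + o)) 0 with h | h
          · -- Only `o = 0` is at distance zero, and its term `(0 ^ 2)⁻¹` vanishes.
            have ho : o = 0 := by
              by_contra hne
              exact (tdist_pos (u := u) (v := u + o) (by simpa using hne)).ne' h
            subst ho
            simpa using weight_nonneg u u
          · have hle : tdist u (u + o) ≤ o.1 + o.2 :=
              Nat.add_le_add (circDist_add_le u.1 o.1) (circDist_add_le u.2 o.2)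
            have h' : (0 : ℝ) < tdist u (u + o) := by exact_mod_cast Nat.pos_of_ne_zero h
            have hle' : (tdist u (u + o) : ℝ) ≤ (o.1 : ℝ) + (o.2 : ℝ) := by exact_mod_cast hle
            unfold weight
            gcongr
      _ = ∑ w, weight u w := Equiv.sum_comp (Equiv.addLeft u) fun w => weight u w
      _ = ∑ w ∈ Finset.univ.erase u, weight u w := by
          rw [← Finset.add_sum_erase _ _ (Finset.mem_univ u)]
          simp [weight, tdist_self]
  calc normFactor u ≤ ((∑ i ∈ Finset.range n, (i : ℝ)⁻¹) / 4)⁻¹ :=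
        inv_anti₀ (by positivity) hsum
    _ = normBound n := by rw [normBound, inv_div, div_eq_mul_inv]

/-! ### The probability of a four-cycle with a long-range edge -/

theorem choiceLaw_real_singleton_le {n : ℕ} (hn : 2 ≤ n) (u v : Vertex n) :
    (choiceLaw u).real {v} ≤ normBound n * weight u v := by
  have h : (choiceLaw u).real {v} = if v = u then 0 else normFactor u * weight u v := by
    have hmem : ∀ w, Measure.dirac w ({v} : Set (Vertex n)) = if w = v then 1 else 0 := by
      intro w
      rw [Measure.dirac_apply]
      by_cases hw : w = v <;> simp [hw]
    simp only [Measure.real, choiceLaw, Measure.coe_finsetSum, Finset.sum_apply,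
      Measure.smul_apply, smul_eq_mul, hmem, mul_ite, mul_one, mul_zero]
    rw [Finset.sum_ite_eq']
    by_cases hv : v = u
    · simp [hv]
    · simp only [Finset.mem_erase, Finset.mem_univ, and_true, hv, ne_eq, not_false_eq_true,
        if_true, if_false]
      exact ENNReal.toReal_ofReal (mul_nonneg (normFactor_nonneg u) (weight_nonneg u v))
  have hle := mul_le_mul_of_nonneg_right (normFactor_le hn u) (weight_nonneg u v)
  rw [h]
  split_ifs with hv
  · exact (mul_nonneg (normFactor_nonneg u) (weight_nonneg u v)).trans hle
  · exact hle

theorem isProbabilityMeasure_choicesLaw {n : ℕ} (hn : 2 ≤ n) :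
    IsProbabilityMeasure (choicesLaw n) := by
  have := fun u : Vertex n => isProbabilityMeasure_choiceLaw hn u
  unfold choicesLaw
  infer_instance

/-- Distinct requirements on the choices are either requirements on distinct vertices, hence
independent, or contradictory. -/
theorem choicesLaw_real_forall_eq_le {n : ℕ} (hn : 2 ≤ n) {ι : Type*} (s : Finset ι)
    (a b : ι → Vertex n) (hinj : ∀ i ∈ s, ∀ j ∈ s, a i = a j → b i = b j → i = j) :
    (choicesLaw n).real {ω | ∀ i ∈ s, ω (a i) = b i} ≤
      ∏ i ∈ s, (choiceLaw (a i)).real {b i} := by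
  have := fun u : Vertex n => isProbabilityMeasure_choiceLaw hn u
  by_cases ha : Set.InjOn a s
  · have hset : {ω : Choices n | ∀ i ∈ s, ω (a i) = b i} =
        Set.univ.pi fun x => {y | ∀ i ∈ s, a i = x → y = b i} := by
      ext ω
      simp only [Set.mem_ofPred_eq, Set.mem_pi, Set.mem_univ, true_imp_iff]
      exact ⟨fun h x i hi hx => hx ▸ h i hi, fun h i hi => h _ i hi rfl⟩
    rw [hset, Measure.real, choicesLaw, Measure.pi_pi, ENNReal.toReal_prod]
    calc ∏ x, (choiceLaw x {y | ∀ i ∈ s, a i = x → y = b i}).toReal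
        ≤ ∏ x ∈ s.image a, (choiceLaw x {y | ∀ i ∈ s, a i = x → y = b i}).toReal := by
          rw [← Finset.prod_sdiff (Finset.subset_univ (s.image a))]
          refine mul_le_of_le_one_left (Finset.prod_nonneg fun _ _ => ENNReal.toReal_nonneg) ?_
          exact Finset.prod_le_one (fun _ _ => ENNReal.toReal_nonneg) fun _ _ => measureReal_le_one
      _ = ∏ i ∈ s, (choiceLaw (a i)).real {y | ∀ j ∈ s, a j = a i → y = b j} :=
          Finset.prod_image ha
      _ ≤ ∏ i ∈ s, (choiceLaw (a i)).real {b i} := by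
          refine Finset.prod_le_prod (fun _ _ => measureReal_nonneg) fun i hi => ?_
          exact measureReal_mono fun y hy => hy i hi rfl
  · simp only [Set.InjOn, not_forall] at ha
    obtain ⟨i, hi, j, hj, hij, hne⟩ := ha
    have hempty : {ω : Choices n | ∀ i ∈ s, ω (a i) = b i} = ∅ := by
      ext ω
      simp only [Set.mem_ofPred_eq, Set.mem_empty_iff_false, iff_false]
      intro h
      exact hne (hinj i hi j hj hij (by rw [← h i hi, ← h j hj, hij]))
    rw [hempty, measureReal_empty]
    exact Finset.prod_nonneg fun _ _ => measureReal_nonneg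

/-- The ways in which an edge `{a, b}` can arise: it belongs to the torus (`none`), or `a` chose `b`
(`some true`), or `b` chose `a` (`some false`). -/
def ArisesBy {n : ℕ} (ω : Choices n) (a b : Vertex n) : Option Bool → Prop
  | none => (torus n).Adj a b
  | some true => ω a = b
  | some false => ω b = a

theorem exists_arisesBy {n : ℕ} {ω : Choices n} {a b : Vertex n} (h : (graph ω).Adj a b) :
    ∃ o, ArisesBy ω a b o := by
  rw [graph, SimpleGraph.sup_adj, SimpleGraph.fromRel_adj] at h
  rcases h with h | ⟨-, h | h⟩
  · exact ⟨none, h⟩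
  · exact ⟨some true, h⟩
  · exact ⟨some false, h⟩

/-- The event that `p` is a four-cycle whose edges arise in the ways `o`. Of the normalizing factors
of its long-range edges only that of the first edge is kept; the others are at most one. -/
theorem choicesLaw_real_cycle_le {n : ℕ} (hn : 2 ≤ n) (hZ : normBound n ≤ 1)
    {p : Fin 4 → Vertex n} (hp : Function.Injective p) {o : Fin 4 → Option Bool}
    (ho : o 0 ≠ none) :
    (choicesLaw n).real {ω | ∀ i, ArisesBy ω (p i) (p (i + 1)) (o i)} ≤
      normBound n * ∏ i, weight (p i) (p (i + 1)) := by
  have := isProbabilityMeasure_choicesLaw hn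
  have hZ0 : 0 ≤ normBound n := (normFactor_nonneg (p 0)).trans (normFactor_le hn _)
  by_cases htorus : ∀ i, o i = none → (torus n).Adj (p i) (p (i + 1))
  swap
  · push Not at htorus
    obtain ⟨i, hi, hadj⟩ := htorus
    have hempty : {ω | ∀ i, ArisesBy ω (p i) (p (i + 1)) (o i)} = ∅ := by
      ext ω
      simp only [Set.mem_ofPred_eq, Set.mem_empty_iff_false, iff_false]
      intro h
      have := h i
      rw [hi] at this
      exact hadj this
    rw [hempty, measureReal_empty]
    exact mul_nonneg hZ0 (Finset.prod_nonneg fun _ _ => weight_nonneg _ _)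
  let s : Finset (Fin 4) := Finset.univ.filter fun i => o i ≠ none
  let a : Fin 4 → Fin 4 := fun i => if o i = some true then i else i + 1
  let b : Fin 4 → Fin 4 := fun i => if o i = some true then i + 1 else i
  have hab : ∀ i j, a i = a j → b i = b j → i = j := by
    intro i j
    have key : ∀ (P Q : Bool) (i j : Fin 4), (if P then i else i + 1) = (if Q then j else j + 1) →
      (if P then i + 1 else i) = (if Q then j + 1 else j) → i = j := by decide
    simpa [a, b] using key (decide (o i = some true)) (decide (o j = some true)) i j
  have hweight : ∀ i, weight (p (a i)) (p (b i)) = weight (p i) (p (i + 1)) := by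
    intro i
    simp only [a, b]
    split_ifs
    · rfl
    · exact weight_comm _ _
  calc (choicesLaw n).real {ω | ∀ i, ArisesBy ω (p i) (p (i + 1)) (o i)}
      ≤ (choicesLaw n).real {ω | ∀ i ∈ s, ω (p (a i)) = p (b i)} := by
        refine measureReal_mono fun ω hω i hi => ?_
        have h := hω i
        have hi' : o i ≠ none := (Finset.mem_filter.1 hi).2
        simp only [a, b]
        match hoi : o i with
        | none => exact absurd hoi hi'
        | some true => rw [hoi] at h; simpa using (show ω (p i) = p (i + 1) from h)
        | some false => rw [hoi] at h; simpa using (show ω (p (i + 1)) = p i from h)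
    _ ≤ ∏ i ∈ s, (choiceLaw (p (a i))).real {p (b i)} :=
        choicesLaw_real_forall_eq_le hn s _ _ fun i _ j _ h₁ h₂ => hab i j (hp h₁) (hp h₂)
    _ ≤ ∏ i ∈ s, normBound n * weight (p i) (p (i + 1)) := by
        refine Finset.prod_le_prod (fun _ _ => measureReal_nonneg) fun i _ => ?_
        rw [← hweight]
        exact choiceLaw_real_singleton_le hn _ _
    _ = ∏ i, if o i ≠ none then normBound n * weight (p i) (p (i + 1)) else 1 :=
        Finset.prod_filter _ _
    _ ≤ ∏ i, (if i = 0 then normBound n else 1) * weight (p i) (p (i + 1)) := by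
        refine Finset.prod_le_prod (fun i _ => ?_) fun i _ => ?_
        · split_ifs
          · exact mul_nonneg hZ0 (weight_nonneg _ _)
          · exact zero_le_one
        · rcases eq_or_ne i 0 with rfl | hi
          · rw [if_pos ho, if_pos rfl]
          · rw [if_neg hi, one_mul]
            split_ifs with hoi
            · exact mul_le_of_le_one_left (weight_nonneg _ _) hZ
            · rw [weight_eq_one (htorus i (not_not.1 hoi))]
    _ = normBound n * ∏ i, weight (p i) (p (i + 1)) := by
        rw [Finset.prod_mul_distrib, Finset.prod_ite_eq' Finset.univ (0 : Fin 4)]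
        simp

theorem choicesLaw_real_notMem_detected_le {n : ℕ} (hn : 3 ≤ n) (hZ : normBound n ≤ 1)
    (run : ∀ ω : Choices n, LRERARun (graph ω)) (u : Vertex n) :
    (choicesLaw n).real {ω | u ∉ (run ω).detected} ≤
      81 * ((8 * decayConst) ^ 2 * decayConst) * normBound n := by
  have := isProbabilityMeasure_choicesLaw (n := n) (by omega)
  have hZ0 : 0 ≤ normBound n := (normFactor_nonneg u).trans (normFactor_le (by omega) _)
  let p : Vertex n × Vertex n × Vertex n → Fin 4 → Vertex n :=
    fun q => ![u, q.2.1, q.1, q.2.2]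
  let A : (Vertex n × Vertex n × Vertex n) × (Fin 4 → Option Bool) → Set (Choices n) := fun q =>
    {ω | (Function.Injective (p q.1) ∧ q.2 0 ≠ none) ∧
      ∀ i, ArisesBy ω (p q.1 i) (p q.1 (i + 1)) (q.2 i)}
  let T : Finset ((Vertex n × Vertex n × Vertex n) × (Fin 4 → Option Bool)) :=
    ((Finset.univ.erase u) ×ˢ Finset.univ ×ˢ Finset.univ) ×ˢ Finset.univ
  have hsub : {ω | u ∉ (run ω).detected} ⊆ ⋃ q ∈ T, A q := by
    intro ω hω
    obtain ⟨v, x, w, h₁, h₂, h₃, h₄, hx, hw, hlong⟩ := exists_cycle_of_notMem_detected hn (run ω) hω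
    have harise : ∀ i, ∃ o, ArisesBy ω (p (x, v, w) i) (p (x, v, w) (i + 1)) o := by
      intro i
      fin_cases i
      · exact exists_arisesBy h₁
      · exact exists_arisesBy h₂
      · exact exists_arisesBy h₃
      · exact exists_arisesBy h₄
    choose o ho using harise
    simp only [Set.mem_iUnion]
    refine ⟨((x, v, w), o), by simp [T, hx], ⟨?_, ?_⟩, ho⟩
    · intro i j
      fin_cases i <;> fin_cases j <;> simp [p, h₁.ne, h₁.ne', h₂.ne, h₂.ne', h₃.ne, h₃.ne', h₄.ne,
        h₄.ne', hx, hx.symm, hw, hw.symm]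
    · intro (h0 : o 0 = none)
      have := ho 0
      rw [h0] at this
      exact hlong this
  have hA : ∀ q, (choicesLaw n).real (A q) ≤
      normBound n * ∏ i, weight (p q.1 i) (p q.1 (i + 1)) := by
    intro q
    by_cases hq : Function.Injective (p q.1) ∧ q.2 0 ≠ none
    · exact (measureReal_mono fun ω hω => hω.2).trans
        (choicesLaw_real_cycle_le (by omega) hZ hq.1 hq.2)
    · have hempty : A q = ∅ := Set.eq_empty_of_forall_notMem fun ω hω => hq hω.1
      rw [hempty, measureReal_empty]
      exact mul_nonneg hZ0 (Finset.prod_nonneg fun _ _ => weight_nonneg _ _)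
  calc (choicesLaw n).real {ω | u ∉ (run ω).detected}
      ≤ (choicesLaw n).real (⋃ q ∈ T, A q) := measureReal_mono hsub (measure_ne_top _ _)
    _ ≤ ∑ q ∈ T, (choicesLaw n).real (A q) := measureReal_biUnion_finset_le _ _
    _ ≤ ∑ q ∈ T, normBound n * ∏ i, weight (p q.1 i) (p q.1 (i + 1)) :=
        Finset.sum_le_sum fun q _ => hA q
    _ = 81 * normBound n * ∑ x ∈ Finset.univ.erase u, ∑ v, ∑ w,
          weight u v * weight v x * weight x w * weight w u := by
        simp only [T]
        rw [Finset.sum_product]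
        simp only [Finset.sum_const, Finset.card_univ, Fintype.card_fun, Fintype.card_fin,
          Fintype.card_option, Fintype.card_bool, nsmul_eq_mul]
        rw [Finset.sum_product, Finset.mul_sum]
        refine Finset.sum_congr rfl fun x _ => ?_
        rw [Finset.sum_product, Finset.mul_sum]
        refine Finset.sum_congr rfl fun v _ => ?_
        rw [Finset.mul_sum]
        refine Finset.sum_congr rfl fun w _ => ?_
        have hprod : ∏ i, weight (p (x, v, w) i) (p (x, v, w) (i + 1)) =
            weight u v * weight v x * weight x w * weight w u := Fin.prod_univ_four _
        rw [hprod]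
        norm_num
        ring
    _ ≤ 81 * normBound n * ((8 * decayConst) ^ 2 * decayConst) := by
        gcongr
        exact sum_weight_cycle_le u
    _ = 81 * ((8 * decayConst) ^ 2 * decayConst) * normBound n := by ring

theorem integral_card_detected {n : ℕ} (hn : 2 ≤ n) (run : ∀ ω : Choices n, LRERARun (graph ω)) :
    ∫ ω, ((run ω).detected.card : ℝ) ∂(choicesLaw n) =
      ∑ u, (1 - (choicesLaw n).real {ω | u ∉ (run ω).detected}) := by
  have := isProbabilityMeasure_choicesLaw hn
  have hcard : ∀ ω, ((run ω).detected.card : ℝ) =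
      ∑ u, Set.indicator {ω | u ∈ (run ω).detected} (1 : Choices n → ℝ) ω := by
    intro ω
    simp [Set.indicator_apply]
  simp only [hcard]
  rw [integral_finsetSum _ fun u _ => Integrable.of_finite]
  refine Finset.sum_congr rfl fun u _ => ?_
  rw [integral_indicator_one (Set.toFinite _).measurableSet, eq_comm,
    ← probReal_compl_eq_one_sub (Set.toFinite _).measurableSet]
  congr 1
  ext ω
  simp

end UTSW

theorem mainTheorem5
    (run : ∀ (n : ℕ) (ω : UTSW.Choices n), UTSW.LRERARun (UTSW.graph ω)) :
    Tendsto
      (fun n : ℕ =>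
        (∫ ω, ((run n ω).detected.card : ℝ) ∂(UTSW.choicesLaw n)) /
          (Fintype.card (UTSW.Vertex n) : ℝ))
      atTop (𝓝 1) := by
  have hlower : Tendsto (fun n => 1 -
      81 * ((8 * UTSW.decayConst) ^ 2 * UTSW.decayConst) * UTSW.normBound n) atTop (𝓝 1) := by
    simpa using (UTSW.tendsto_normBound.const_mul _).const_sub 1
  have hsmall := UTSW.tendsto_normBound.eventually_le_const zero_lt_one
  refine tendsto_of_tendsto_of_tendsto_of_le_of_le' hlower tendsto_const_nhds ?_ ?_
  · filter_upwards [eventually_ge_atTop 3, hsmall] with n hn hZ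
    have hcard : (0 : ℝ) < Fintype.card (UTSW.Vertex n) := by
      have : Nonempty (UTSW.Vertex n) := ⟨(⟨0, by omega⟩, ⟨0, by omega⟩)⟩
      exact_mod_cast Fintype.card_pos
    rw [le_div_iff₀ hcard, UTSW.integral_card_detected (by omega), mul_comm, ← nsmul_eq_mul,
      ← Finset.card_univ]
    refine Finset.card_nsmul_le_sum _ _ _ fun u _ => ?_
    have := UTSW.choicesLaw_real_notMem_detected_le hn hZ (run n) u
    linarith
  · filter_upwards [eventually_ge_atTop 3] with n hn
    refine div_le_one_of_le₀ ?_ (by positivity)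
    rw [UTSW.integral_card_detected (by omega), ← mul_one (Fintype.card _ : ℝ), ← nsmul_eq_mul,
      ← Finset.card_univ]
    refine Finset.sum_le_card_nsmul _ _ _ fun u _ => ?_
    have : 0 ≤ (UTSW.choicesLaw n).real {ω | u ∉ (run n ω).detected} := measureReal_nonneg
    linarith
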